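/- Write $h(t)=(t,\cos t,\sin t)$ for the circular helix in $\mathbb R^3$. A convex $3$-polytope is a three-dimensional convex hull of finitely many points. A facet of a closed convex set in $\mathbb R^3$ is a two-dimensional face cut out by a supporting plane. A family of sets in $\mathbb R^3$ is called neighborly if every two different members have a two-dimensional intersection. Two sets are congruent if an isometry of $\mathbb R^3$ maps one onto the other. (1) For every positive integer $n$ there is a neighborly family of $n$ congruent convex $3$-polytopes; moreover, the family can be chosen so that the intersection of every two different members is a facet of both. (2) For a positive integer $n$ and $t\in\mathbb Z$ let $h_n(t)=h(2\pi t/n)$, and let $V_n(t)=\{x\in\mathbb R^3 : |x-h_n(t)|\le |x-h_n(s)| \text{ for all } s\in\mathbb Z\}$ be the Voronoi region of $h_n(t)$ with respect to the infinite point set $\{h_n(s): s\in\mathbb Z\}$. Let $H_n(t)=\{(x,y,z): y\cos(2\pi t/n)+z\sin(2\pi t/n)\le n\}$, and let $$g_n(x,y,z)=\Bigl(x+\tfrac{2\pi}{n},\; y\cos\tfrac{2\pi}{n}-z\sin\tfrac{2\pi}{n},\; y\sin\tfrac{2\pi}{n}+z\cos\tfrac{2\pi}{n}\Bigr).$$ The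 screw motion $g_n$ is an isometry, and for every $t\in\mathbb Z$ it maps $h_n(t)$ to $h_n(t+1)$, $V_n(t)$ onto $V_n(t+1)$ and $H_n(t)$ onto $H_n(t+1)$. For every $a\in\mathbb Z$, any two different regions among the $n+1$ consecutive regions $V_n(a),V_n(a+1),\dots,V_n(a+n)$ intersect in a facet of both. (3) If $n\ge 3$, then each clipped region $P_n(t)=V_n(t)\cap H_n(t)$ is a convex $3$-polytope, $g_n$ maps $P_n(t)$ onto $P_n(t+1)$ for every $t\in\mathbb Z$, so that all the $P_n(t)$ are congruent, and for every $a\in\mathbb Z$ the $n+1$ polytopes $P_n(a),P_n(a+1),\dots,P_n(a+n)$ form a neighborly family. (4) (Bitangent Lemma) For every $0<t<\pi$ there is exactly one sphere that passes through $h(t)$ and $h(-t)$ and is tangent to the helix at both points, and this sphere meets the helix only at $h(t)$ and $h(-t)$. -/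

import Mathlib

open scoped Real

/-- Euclidean three-space; the coordinates `0, 1, 2` are `x, y, z`. -/
abbrev E3 : Type := EuclideanSpace ℝ (Fin 3)

/-! ### Convex geometry -/

/-- The dimension of a set in three-space: the dimension of its affine hull
(and `0` for the empty set). -/
noncomputable def setDim (A : Set E3) : ℕ :=
  Module.finrank ℝ (vectorSpan ℝ A)

/-- A convex 3-polytope: a three-dimensional convex hull of finitely many points. -/
def IsConvexPolytope3 (A : Set E3) : Prop :=
  (∃ F : Finset E3, A = convexHull ℝ (F : Set E3)) ∧ setDim A = 3

/-- `F` is a facet of the convex set `A`: a face of `A`, cut out by a supporting hyperplane,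
whose dimension is two. -/
def IsFacet (F A : Set E3) : Prop :=
  IsExposed ℝ A F ∧ setDim F = 2

/-- Two sets are congruent if an isometry of the whole space maps one onto the other. -/
def AreCongruent (A B : Set E3) : Prop :=
  ∃ g : E3 ≃ᵢ E3, g '' A = B

/-- A family is neighborly if any two different members have a two-dimensional intersection. -/
def IsNeighborly {ι : Type*} (P : ι → Set E3) : Prop :=
  Pairwise fun i j => setDim (P i ∩ P j) = 2

/-- Any two different members of the family meet exactly in a facet of both. -/
def MeetInCommonFacets {ι : Type*} (P : ι → Set E3) : Prop :=
  Pairwise fun i j => IsFacet (P i ∩ P j) (P i) ∧ IsFacet (P i ∩ P j) (P j)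

/-- The Voronoi region of the site `p` with respect to the set of sites `S`. -/
def voronoiRegion (S : Set E3) (p : E3) : Set E3 :=
  {x | ∀ q ∈ S, dist x p ≤ dist x q}

/-! ### The helix -/

/-- The circular helix `h(t) = (t, cos t, sin t)`. -/
noncomputable def helix (t : ℝ) : E3 :=
  !₂[t, Real.cos t, Real.sin t]

/-- The tangent line of the helix at `h(t)`. -/
noncomputable def helixTangentLine (t : ℝ) : AffineSubspace ℝ E3 :=
  AffineSubspace.mk' (helix t) (Submodule.span ℝ {deriv helix t})

/-- The sphere passes through `h(t)` and `h(-t)` and is tangent to the helix at both points. -/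
def IsBitangentSphere (S : EuclideanGeometry.Sphere E3) (t : ℝ) : Prop :=
  S.IsTangentAt (helix t) (helixTangentLine t) ∧
    S.IsTangentAt (helix (-t)) (helixTangentLine (-t))

/-- The angular step `θ = 2π/n`. -/
noncomputable def stepAngle (n : ℕ) : ℝ :=
  2 * π / n

/-- The evenly spaced points `h_n(t) = h(2πt/n)`, for `t` an integer. -/
noncomputable def helixPoint (n : ℕ) (t : ℤ) : E3 :=
  helix (2 * π * t / n)

/-- The Voronoi region `V_n(t)` of `h_n(t)` with respect to all the points `h_n(s)`, `s ∈ ℤ`. -/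
noncomputable def helixRegion (n : ℕ) (t : ℤ) : Set E3 :=
  voronoiRegion (Set.range (helixPoint n)) (helixPoint n t)

/-- The clipping halfspace `y cos(2πt/n) + z sin(2πt/n) ≤ n`. -/
noncomputable def clipHalfspace (n : ℕ) (t : ℤ) : Set E3 :=
  {p | p 1 * Real.cos (2 * π * t / n) + p 2 * Real.sin (2 * π * t / n) ≤ n}

/-- The clipped Voronoi region. -/
noncomputable def clippedRegion (n : ℕ) (t : ℤ) : Set E3 :=
  helixRegion n t ∩ clipHalfspace n t

/-- The screw motion: translation by `2π/n` along the `x`-axis combined with the rotation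
by `2π/n` about the `x`-axis. -/
noncomputable def screw (n : ℕ) (p : E3) : E3 :=
  !₂[p 0 + stepAngle n,
    p 1 * Real.cos (stepAngle n) - p 2 * Real.sin (stepAngle n),
    p 1 * Real.sin (stepAngle n) + p 2 * Real.cos (stepAngle n)]

/-! ### Trigonometric inequalities -/

/-! The point (α, -R cos α, -R sin α) lies across the axis from `helix α`, and its squared distance
to `helix (α + s)` is s² + 2R cos s + R² + 1 (`dist_sq_axis_helix`). Everything rests on minimising
s² + 2R cos s. For R = t / sin t with 0 < t < π the minimum over all real s is attained exactly at s
= ±t (`sq_add_cos_lt_of_abs_ne`), because sin s / s decreases. With α = 0 this is the bitangent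
lemma.

For sites i < j with j - i < n, let α be the mean parameter and t half the parameter difference. The
centre is then strictly nearer to these two sites than to all others, so a disc of their bisector
plane around it lies in both Voronoi regions, which therefore share a facet. When j - i = n one has
t = π and t / sin t is unavailable. Now only the discrete sites need to be beaten: their offsets
from α are πe/n with e ≡ n mod 2, and R slightly below max(n, 3) works (`pi_sq_sub_lt_sq_add_cos`).

If n ≥ 3, these centres lie strictly inside the clipping halfspaces, so clipping preserves dimension
two. A Voronoi region bounded in the radial direction of its site is bounded altogether, so finitely
many sites determine the clipped cell, and a bounded polyhedral set is a polytope. To keep the whole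
intersection a facet, all regions are clipped by one large prism invariant under the screw motion.
-/

theorem mul_sin_lt_mul_sin {s t : ℝ} (hs : 0 < s) (hst : s < t) (ht : t ≤ π) :
    s * Real.sin t < t * Real.sin s := by
  have ht0 : 0 < t := hs.trans hst
  have h := strictConcaveOn_sin_Icc.2 ⟨le_rfl, Real.pi_pos.le⟩ ⟨ht0.le, ht⟩ ht0.ne
    (show 0 < 1 - s / t by rw [sub_pos, div_lt_one ht0]; exact hst)
    (show 0 < s / t by positivity) (by ring)
  simp only [smul_eq_mul, mul_zero, zero_add, Real.sin_zero] at h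
  rw [div_mul_cancel₀ _ ht0.ne', div_mul_eq_mul_div, div_lt_iff₀ ht0] at h
  linarith

theorem hasDerivAt_sq_add_cos (R s : ℝ) :
    HasDerivAt (fun s : ℝ => s ^ 2 + 2 * R * Real.cos s) (2 * (s - R * Real.sin s)) s := by
  have h := (hasDerivAt_pow 2 s).add ((Real.hasDerivAt_cos s).const_mul (2 * R))
  exact h.congr_deriv (by norm_num; ring)

/-- The equation for R makes t a critical point. The derivative 2(s - R sin s) is negative before it
because sin s / s exceeds sin t / t there. -/
theorem strictAntiOn_sq_add_cos {R t : ℝ} (ht0 : 0 < t) (ht : t < π) (hR : R * Real.sin t = t) :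
    StrictAntiOn (fun s : ℝ => s ^ 2 + 2 * R * Real.cos s) (Set.Icc 0 t) := by
  apply strictAntiOn_of_deriv_neg (convex_Icc _ _) (by fun_prop)
  intro s hs
  rw [interior_Icc] at hs
  rw [(hasDerivAt_sq_add_cos R s).deriv]
  have h1 := mul_sin_lt_mul_sin hs.1 hs.2 ht.le
  have h2 : 0 < Real.sin t := Real.sin_pos_of_pos_of_lt_pi ht0 ht
  have h3 : s * Real.sin t < R * Real.sin s * Real.sin t := by
    calc _ < _ := h1
      _ = _ := by nth_rw 1 [← hR]; ring
  have := lt_of_mul_lt_mul_right h3 h2.le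
  linarith

theorem strictMonoOn_sq_add_cos {R t : ℝ} (ht0 : 0 < t) (ht : t < π) (hR : R * Real.sin t = t) :
    StrictMonoOn (fun s : ℝ => s ^ 2 + 2 * R * Real.cos s) (Set.Icc t π) := by
  apply strictMonoOn_of_deriv_pos (convex_Icc _ _) (by fun_prop)
  intro s hs
  rw [interior_Icc] at hs
  rw [(hasDerivAt_sq_add_cos R s).deriv]
  have h1 := mul_sin_lt_mul_sin ht0 hs.1 hs.2.le
  have h2 : 0 < Real.sin t := Real.sin_pos_of_pos_of_lt_pi ht0 ht
  have h3 : R * Real.sin s * Real.sin t < s * Real.sin t := by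
    calc _ = R * Real.sin t * Real.sin s := by ring
      _ = t * Real.sin s := by rw [hR]
      _ < _ := h1
  have := lt_of_mul_lt_mul_right h3 h2.le
  linarith

/-- Among the points of the helix, those at parameters `±t` are the closest to the centre of the
bitangent sphere. -/
theorem sq_add_cos_lt_of_abs_ne {R t s : ℝ} (ht0 : 0 < t) (ht : t < π) (hR : R * Real.sin t = t)
    (hs : |s| ≠ t) : t ^ 2 + 2 * R * Real.cos t < s ^ 2 + 2 * R * Real.cos s := by
  rw [← sq_abs s, ← Real.cos_abs s]
  have hs0 := abs_nonneg s
  generalize |s| = s at hs hs0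
  have hm := strictMonoOn_sq_add_cos ht0 ht hR
  rcases lt_or_gt_of_ne hs with h | h
  · exact strictAntiOn_sq_add_cos ht0 ht hR ⟨hs0, h.le⟩ ⟨ht0.le, le_rfl⟩ h
  rcases le_or_gt s π with h' | h'
  · exact hm ⟨le_rfl, ht.le⟩ ⟨h.le, h'⟩ h
  -- Past π the cosine no longer has to be followed: s² - 2R > π² - 2R, and the latter is the value
  -- at π.
  · have h1 := hm ⟨le_rfl, ht.le⟩ ⟨ht.le, le_rfl⟩ ht
    have h2 : 0 < Real.sin t := Real.sin_pos_of_pos_of_lt_pi ht0 ht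
    have hR0 : 0 < R := pos_of_mul_pos_left (by rw [hR]; exact ht0) h2.le
    have h3 : π ^ 2 < s ^ 2 := by
      have := Real.pi_pos
      nlinarith
    have h4 := Real.neg_one_le_cos s
    simp only [Real.cos_pi] at h1
    nlinarith

/-- Put x = 2y and bound sin 2y = 2 sin y cos y below by Taylor polynomials. After division by (2y)²
a polynomial inequality on 0 < y ≤ 0.525 remains, where 0.525 = 3.15/6 bounds π/6. -/
theorem sq_mul_pi_sub_lt {x : ℝ} (hx : 0 < x) (hx3 : x ≤ π / 3) :
    x ^ 2 * (π - x) < π * Real.sin x ^ 2 := by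
  obtain ⟨y, rfl⟩ : ∃ y, x = 2 * y := ⟨x / 2, by ring⟩
  have hy : 0 < y := by linarith
  have hp := Real.pi_lt_d2
  have hp' := Real.pi_gt_d2
  have hy3 : y ≤ 0.525 := by linarith
  have hs := Real.sin_gt_sub_cube hy
  have hc := Real.one_sub_sq_div_two_le_cos (x := y)
  have hy2 : y ^ 2 ≤ 0.525 ^ 2 := by gcongr
  have h1 : 2 * ((y - y ^ 3 / 6) * (1 - y ^ 2 / 2)) ≤ Real.sin (2 * y) := by
    rw [Real.sin_two_mul, mul_assoc]
    have : 0 ≤ y - y ^ 3 / 6 := by nlinarith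
    have : 0 ≤ Real.sin y := this.trans hs.le
    have : 0 ≤ 1 - y ^ 2 / 2 := by nlinarith
    gcongr
  have h2 : (2 * ((y - y ^ 3 / 6) * (1 - y ^ 2 / 2))) ^ 2 ≤ Real.sin (2 * y) ^ 2 := by
    have h0 : 0 ≤ 2 * ((y - y ^ 3 / 6) * (1 - y ^ 2 / 2)) := by
      have : 0 ≤ y - y ^ 3 / 6 := by nlinarith
      have : 0 ≤ 1 - y ^ 2 / 2 := by nlinarith
      positivity
    gcongr
  have h3 : π - 2 * y < π * ((1 - y ^ 2 / 6) * (1 - y ^ 2 / 2)) ^ 2 := by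
    have h4 : 1 - 4 / 3 * y ^ 2 + 11 / 18 * y ^ 4 - 1 / 9 * y ^ 6 ≤
        ((1 - y ^ 2 / 6) * (1 - y ^ 2 / 2)) ^ 2 := by
      have : 0 ≤ y ^ 8 := by positivity
      nlinarith
    have h5 : 4 / 3 * y - 11 / 18 * y ^ 3 + 1 / 9 * y ^ 5 ≤ 0.63 := by
      have : y ^ 5 ≤ 0.525 ^ 2 * y ^ 3 := by
        have : 0 ≤ y ^ 3 := by positivity
        nlinarith
      nlinarith [mul_nonneg hy.le (sub_nonneg.2 hy3), sq_nonneg (y - 0.525),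
        mul_nonneg (sq_nonneg (y - 0.525)) hy.le]
    have h6 : π * (4 / 3 * y - 11 / 18 * y ^ 3 + 1 / 9 * y ^ 5) < 2 := by nlinarith
    have h7 := mul_le_mul_of_nonneg_left h4 Real.pi_pos.le
    nlinarith [mul_lt_mul_of_pos_right h6 hy]
  calc _ = (2 * y) ^ 2 * (π - 2 * y) := rfl
    _ < (2 * y) ^ 2 * (π * ((1 - y ^ 2 / 6) * (1 - y ^ 2 / 2)) ^ 2) := by gcongr
    _ = π * (2 * ((y - y ^ 3 / 6) * (1 - y ^ 2 / 2))) ^ 2 := by ring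
    _ ≤ _ := by have := Real.pi_pos; gcongr

/-- The left side is the value at s = π. The function falls up to a critical point t = m sin t and
rises from there to π. At s₁ = π - 2π/m it exceeds its value at π, so s₁ lies on the falling branch,
and every smaller s gives at least the value at s₁. -/
theorem pi_sq_sub_lt_sq_add_cos {m s : ℝ} (hm : 3 ≤ m) (hs0 : 0 ≤ s) (hs : s ≤ π - 2 * π / m) :
    π ^ 2 - 2 * m < s ^ 2 + 2 * m * Real.cos s := by
  have hp := Real.pi_pos
  have hp3 := Real.pi_lt_d2
  obtain ⟨t, ht, htm⟩ : ∃ t ∈ Set.Icc (π / 2) π, t - m * Real.sin t = 0 := by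
    apply intermediate_value_Icc (by linarith) (by fun_prop)
    simp only [Real.sin_pi, Real.sin_pi_div_two, Set.mem_Icc]
    constructor <;> linarith
  have htπ : t < π := by
    rcases ht.2.lt_or_eq with h | rfl
    · exact h
    · simp at htm
  have ht0 : 0 < t := by linarith [ht.1]
  have hR : m * Real.sin t = t := by linarith
  have hanti := strictAntiOn_sq_add_cos ht0 htπ hR
  have hmono := strictMonoOn_sq_add_cos ht0 htπ hR
  set s₁ := π - 2 * π / m with hs₁
  have hm0 : 0 < m := by linarith
  -- With x = π/m the claim becomes x(π - x) < m sin² x; multiplying by x turns it into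
  -- `sq_mul_pi_sub_lt`.
  have key : π ^ 2 - 2 * m < s₁ ^ 2 + 2 * m * Real.cos s₁ := by
    have hx : 0 < π / m := by positivity
    have h := sq_mul_pi_sub_lt hx (by gcongr)
    have hs₁' : s₁ = π - 2 * (π / m) := by rw [hs₁]; ring
    have hmx : m * (π / m) = π := by field_simp
    generalize π / m = x at *
    rw [hs₁', Real.cos_pi_sub, Real.cos_two_mul, Real.cos_sq']
    have h2 : x * (x * (π - x)) < x * (m * Real.sin x ^ 2) := by
      calc _ = x ^ 2 * (π - x) := by ring
        _ < _ := h
        _ = _ := by rw [← hmx]; ring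
    have := lt_of_mul_lt_mul_left h2 hx.le
    nlinarith
  have hs₁π : s₁ < π := by rw [hs₁]; linarith [show 0 < 2 * π / m by positivity]
  have hs₁t : s₁ < t := by
    by_contra! hc
    have := hmono ⟨hc, hs₁π.le⟩ ⟨htπ.le, le_rfl⟩ hs₁π
    simp only [Real.cos_pi] at this
    linarith
  have := hanti.antitoneOn ⟨hs0, hs.trans hs₁t.le⟩ ⟨hs0.trans hs, hs₁t.le⟩ hs
  exact key.trans_le this

theorem mul_cos_lt_mul_sin {u : ℝ} (h0 : 0 < u) (h : u < π / 2) :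
    u * Real.cos u < Real.sin u := by
  have hc : 0 < Real.cos u := Real.cos_pos_of_mem_Ioo ⟨by linarith, h⟩
  have := Real.lt_tan h0 h
  rwa [Real.tan_eq_sin_div_cos, lt_div_iff₀ hc] at this

theorem mul_cos_lt_sin_of_lt_pi {t : ℝ} (h0 : 0 < t) (h : t < π) :
    t * Real.cos t < Real.sin t := by
  rcases lt_or_ge t (π / 2) with h' | h'
  · exact mul_cos_lt_mul_sin h0 h'
  · have hs := Real.sin_pos_of_pos_of_lt_pi h0 h
    have hc := Real.cos_nonpos_of_pi_div_two_le_of_le h' (by linarith)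
    nlinarith

/-! ### Polytopes and facets -/

/-- A finite intersection of closed halfspaces. -/
def IsPolyhedral (A : Set E3) : Prop :=
  ∃ F : Set (E3 × ℝ), F.Finite ∧ A = {x | ∀ f ∈ F, inner ℝ f.1 x ≤ f.2}

theorem IsPolyhedral.inter {A B : Set E3} (hA : IsPolyhedral A) (hB : IsPolyhedral B) :
    IsPolyhedral (A ∩ B) := by
  obtain ⟨F, hF, rfl⟩ := hA
  obtain ⟨G, hG, rfl⟩ := hB
  refine ⟨F ∪ G, hF.union hG, ?_⟩
  ext x
  simp only [Set.mem_inter_iff, Set.mem_ofPred_eq, Set.mem_union, or_imp, forall_and]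

theorem IsPolyhedral.convex {A : Set E3} (hA : IsPolyhedral A) : Convex ℝ A := by
  obtain ⟨F, hF, rfl⟩ := hA
  simp only [Set.ofPred_forall]
  exact convex_iInter fun f => convex_iInter fun _ =>
    convex_halfSpace_le (innerSL ℝ f.1).isLinear f.2

theorem IsPolyhedral.isClosed {A : Set E3} (hA : IsPolyhedral A) : IsClosed A := by
  obtain ⟨F, hF, rfl⟩ := hA
  simp only [Set.ofPred_forall]
  exact isClosed_iInter fun f => isClosed_iInter fun _ =>
    isClosed_le (by fun_prop) continuous_const

/-- An extreme point is determined by its set of active constraints: if x and y share theirs, x can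
move a little both ways along y - x without leaving the set. -/
theorem IsPolyhedral.finite_extremePoints {A : Set E3} (hA : IsPolyhedral A) :
    (A.extremePoints ℝ).Finite := by
  obtain ⟨F, hF, rfl⟩ := hA
  refine Set.Finite.of_injOn (f := fun x => {f ∈ F | inner ℝ f.1 x = f.2})
    (t := {G | G ⊆ F}) (fun x _ => Set.sep_subset _ _) ?_ hF.finite_subsets
  intro x hx y hy hxy
  rw [mem_extremePoints_iff_left] at hx
  by_contra hne
  have hev : ∀ᶠ δ : ℝ in nhdsWithin 0 (Set.Ioi 0),
      ∀ f ∈ F, inner ℝ f.1 x + δ * |inner ℝ f.1 (y - x)| ≤ f.2 := by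
    rw [Filter.eventually_all_finite hF]
    intro f hf
    by_cases hfx : inner ℝ f.1 x = f.2
    · have hfy : f ∈ {f ∈ F | inner ℝ f.1 y = f.2} := by
        have hxy' : {f ∈ F | inner ℝ f.1 x = f.2} = {f ∈ F | inner ℝ f.1 y = f.2} := hxy
        rw [← hxy']; exact ⟨hf, hfx⟩
      refine Filter.Eventually.of_forall fun δ => ?_
      rw [inner_sub_right, hfy.2, hfx]
      simp
    · have hlt : inner ℝ f.1 x < f.2 := lt_of_le_of_ne (hx.1 f hf) hfx
      have hc : Continuous fun δ : ℝ => inner ℝ f.1 x + δ * |inner ℝ f.1 (y - x)| := by fun_prop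
      have := hc.continuousAt.eventually_lt (x₀ := (0 : ℝ)) continuousAt_const
        (show _ < f.2 by simpa using hlt)
      exact (this.filter_mono nhdsWithin_le_nhds).mono fun _ h => h.le
  obtain ⟨δ, hδ, hδ0⟩ := (hev.and self_mem_nhdsWithin).exists
  have hδ0 : 0 < δ := hδ0
  have hmem : ∀ ε : ℝ, |ε| = δ → ∀ f ∈ F, inner ℝ f.1 (x + ε • (y - x)) ≤ f.2 := by
    intro ε hε f hf
    rw [inner_add_right, inner_smul_right]
    have h1 := hδ f hf
    have h2 := le_abs_self (ε * inner ℝ f.1 (y - x))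
    rw [abs_mul, hε] at h2
    linarith
  have := hx.2 (x + δ • (y - x)) (hmem δ (abs_of_pos hδ0)) (x + (-δ) • (y - x))
    (hmem (-δ) (by rw [abs_neg, abs_of_pos hδ0]))
    ⟨1 / 2, 1 / 2, by norm_num, by norm_num, by norm_num, by module⟩
  rw [add_eq_left, smul_eq_zero, sub_eq_zero] at this
  rcases this with h | h
  · exact hδ0.ne' h
  · exact hne h.symm

theorem IsPolyhedral.exists_eq_convexHull {A : Set E3} (hA : IsPolyhedral A)
    (hb : Bornology.IsBounded A) : ∃ F : Finset E3, A = convexHull ℝ (F : Set E3) := by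
  refine ⟨hA.finite_extremePoints.toFinset, ?_⟩
  rw [Set.Finite.coe_toFinset]
  have hcomp : IsCompact A := Metric.isCompact_of_isClosed_isBounded hA.isClosed hb
  have hcl : IsClosed (convexHull ℝ (A.extremePoints ℝ)) :=
    (hA.finite_extremePoints.isCompact_convexHull ℝ).isClosed
  rw [← hcl.closure_eq, closure_convexHull_extremePoints hcomp hA.convex]

theorem setDim_eq_three {A : Set E3} {p : E3} (h : A ∈ nhds p) : setDim A = 3 := by
  have hA : affineSpan ℝ A = ⊤ :=
    affineSpan_eq_top_of_nonempty_interior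
      ⟨p, interior_mono (subset_convexHull ℝ A) (mem_interior_iff_mem_nhds.2 h)⟩
  rw [setDim, ← direction_affineSpan, hA, AffineSubspace.direction_top, finrank_top,
    finrank_euclideanSpace_fin]

theorem dist_le_dist_iff_inner_le (x p q : E3) :
    dist x p ≤ dist x q ↔ inner ℝ (q - p) x ≤ (‖q‖ ^ 2 - ‖p‖ ^ 2) / 2 := by
  rw [← sq_le_sq₀ dist_nonneg dist_nonneg, dist_eq_norm, dist_eq_norm, norm_sub_sq_real,
    norm_sub_sq_real, inner_sub_left, real_inner_comm x q, real_inner_comm x p]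
  constructor <;> intro h <;> linarith

theorem dist_eq_dist_iff_inner_eq (x p q : E3) :
    dist x p = dist x q ↔ inner ℝ (q - p) x = (‖q‖ ^ 2 - ‖p‖ ^ 2) / 2 := by
  rw [← sq_eq_sq₀ dist_nonneg dist_nonneg, dist_eq_norm, dist_eq_norm, norm_sub_sq_real,
    norm_sub_sq_real, inner_sub_left, real_inner_comm x q, real_inner_comm x p]
  constructor <;> intro h <;> linarith

theorem isPolyhedral_dist_le_dist (p q : E3) : IsPolyhedral {x | dist x p ≤ dist x q} :=
  ⟨{(q - p, (‖q‖ ^ 2 - ‖p‖ ^ 2) / 2)}, Set.finite_singleton _, by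
    simp [dist_le_dist_iff_inner_le]⟩

/-- A set in the bisector plane of two points that contains a relative neighbourhood of a point of
that plane is two-dimensional. -/
theorem setDim_eq_two {A C : Set E3} {p q c : E3} (hpq : p ≠ q) (hc : dist c p = dist c q)
    (hA : ∀ x ∈ A, dist x p = dist x q) (hC : C ∈ nhds c)
    (hCA : ∀ x ∈ C, dist x p = dist x q → x ∈ A) : setDim A = 2 := by
  have hspan : vectorSpan ℝ A = (ℝ ∙ (q - p))ᗮ := by
    apply le_antisymm
    · rw [vectorSpan, Submodule.span_le]
      rintro _ ⟨x, hx, y, hy, rfl⟩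
      have h1 := (dist_eq_dist_iff_inner_eq x p q).1 (hA x hx)
      have h2 := (dist_eq_dist_iff_inner_eq y p q).1 (hA y hy)
      simp only [SetLike.mem_coe, Submodule.mem_orthogonal_singleton_iff_inner_right, vsub_eq_sub,
        inner_sub_right, h1, h2, sub_self]
    · intro v hv
      rw [Submodule.mem_orthogonal_singleton_iff_inner_right] at hv
      have hcont : ContinuousAt (fun ε : ℝ => c + ε • v) 0 := by fun_prop
      have hev : ∀ᶠ ε : ℝ in nhdsWithin 0 (Set.Ioi 0), c + ε • v ∈ C :=
        (hcont.eventually_mem (by simpa using hC)).filter_mono nhdsWithin_le_nhds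
      obtain ⟨ε, hε, hε0⟩ := (hev.and self_mem_nhdsWithin).exists
      have hε0 : 0 < ε := hε0
      have hin := (dist_eq_dist_iff_inner_eq c p q).1 hc
      have h1 : c + ε • v ∈ A := hCA _ hε <| by
        rw [dist_eq_dist_iff_inner_eq, inner_add_right, inner_smul_right, hv, hin]; simp
      have h2 : c ∈ A := hCA _ (mem_of_mem_nhds hC) hc
      have h3 := vsub_mem_vectorSpan ℝ h1 h2
      rw [vsub_eq_sub, add_sub_cancel_left] at h3
      exact (Submodule.smul_mem_iff _ hε0.ne').1 h3
  have : Fact (Module.finrank ℝ E3 = 2 + 1) := ⟨by simp⟩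
  rw [setDim, hspan]
  exact Submodule.finrank_orthogonal_span_singleton (sub_ne_zero.2 hpq.symm)

/-- The functional ⟨q - p, ·⟩ is bounded on `A` by its value on the bisector plane, so that plane
supports `A`. -/
theorem isExposed_dist_eq_dist {A B : Set E3} {p q : E3} (hA : ∀ x ∈ A, dist x p ≤ dist x q)
    (hB : B = {x ∈ A | dist x p = dist x q}) : IsExposed ℝ A B := by
  rintro ⟨b, hb⟩
  refine ⟨innerSL ℝ (q - p), ?_⟩
  have hAle : ∀ x ∈ A, inner ℝ (q - p) x ≤ (‖q‖ ^ 2 - ‖p‖ ^ 2) / 2 := fun x hx =>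
    (dist_le_dist_iff_inner_le x p q).1 (hA x hx)
  rw [hB] at hb
  have hbeq := (dist_eq_dist_iff_inner_eq b p q).1 hb.2
  subst hB
  ext x
  simp only [Set.mem_ofPred_eq, innerSL_apply_apply, dist_eq_dist_iff_inner_eq]
  refine and_congr_right fun hx => ⟨fun h y hy => h ▸ hAle y hy, fun h => ?_⟩
  exact le_antisymm (hAle x hx) (hbeq ▸ h b hb.1)

/-! ### The screw motions -/

theorem dist_sq_eq_coord (x y : E3) :
    dist x y ^ 2 = (x 0 - y 0) ^ 2 + (x 1 - y 1) ^ 2 + (x 2 - y 2) ^ 2 := by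
  simp [EuclideanSpace.dist_sq_eq, Fin.sum_univ_three, Real.dist_eq, sq_abs]

theorem abs_coord_zero_sub_le_dist (x y : E3) : |x 0 - y 0| ≤ dist x y := by
  refine abs_le_of_sq_le_sq ?_ dist_nonneg
  rw [dist_sq_eq_coord]
  nlinarith [sq_nonneg (x 1 - y 1), sq_nonneg (x 2 - y 2)]

/-- The screw motion along the first axis by the angle `φ`. -/
noncomputable def screwBy (φ : ℝ) (p : E3) : E3 :=
  !₂[p 0 + φ, p 1 * Real.cos φ - p 2 * Real.sin φ, p 1 * Real.sin φ + p 2 * Real.cos φ]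

@[simp] theorem screwBy_apply_zero (φ : ℝ) (p : E3) : screwBy φ p 0 = p 0 + φ := rfl

@[simp] theorem screwBy_apply_one (φ : ℝ) (p : E3) :
    screwBy φ p 1 = p 1 * Real.cos φ - p 2 * Real.sin φ := rfl

@[simp] theorem screwBy_apply_two (φ : ℝ) (p : E3) :
    screwBy φ p 2 = p 1 * Real.sin φ + p 2 * Real.cos φ := rfl

@[simp] theorem helix_apply_zero (t : ℝ) : helix t 0 = t := rfl

@[simp] theorem helix_apply_one (t : ℝ) : helix t 1 = Real.cos t := rfl

@[simp] theorem helix_apply_two (t : ℝ) : helix t 2 = Real.sin t := rfl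

theorem E3.ext {x y : E3} (h0 : x 0 = y 0) (h1 : x 1 = y 1) (h2 : x 2 = y 2) : x = y := by
  ext i
  fin_cases i <;> assumption

theorem screwBy_screwBy (φ ψ : ℝ) (p : E3) : screwBy φ (screwBy ψ p) = screwBy (φ + ψ) p := by
  apply E3.ext <;> simp only [screwBy_apply_zero, screwBy_apply_one, screwBy_apply_two,
    Real.cos_add, Real.sin_add] <;> ring

theorem screwBy_zero (p : E3) : screwBy 0 p = p := by
  apply E3.ext <;> simp

theorem screwBy_helix (φ s : ℝ) : screwBy φ (helix s) = helix (s + φ) := by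
  apply E3.ext <;> simp [Real.cos_add, Real.sin_add]
  ring

theorem isometry_screwBy (φ : ℝ) : Isometry (screwBy φ) := by
  refine Isometry.of_dist_eq fun x y => ?_
  rw [← sq_eq_sq₀ dist_nonneg dist_nonneg, dist_sq_eq_coord, dist_sq_eq_coord]
  simp only [screwBy_apply_zero, screwBy_apply_one, screwBy_apply_two]
  linear_combination ((x 1 - y 1) ^ 2 + (x 2 - y 2) ^ 2) * Real.sin_sq_add_cos_sq φ

/-- The screw motion by the angle `φ`, as an isometry of the whole space. -/
noncomputable def screwEquiv (φ : ℝ) : E3 ≃ᵢ E3 where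
  toFun := screwBy φ
  invFun := screwBy (-φ)
  left_inv p := by rw [screwBy_screwBy, neg_add_cancel, screwBy_zero]
  right_inv p := by rw [screwBy_screwBy, add_neg_cancel, screwBy_zero]
  isometry_toFun := isometry_screwBy φ

theorem mem_screwBy_image_iff {φ : ℝ} {A : Set E3} {x : E3} :
    x ∈ screwBy φ '' A ↔ screwBy (-φ) x ∈ A :=
  Set.ext_iff.1 ((screwEquiv φ).image_eq_preimage_symm A) x

theorem screw_eq_screwBy (n : ℕ) : screw n = screwBy (2 * π * (1 : ℤ) / n) := by
  funext p
  simp [screw, screwBy, stepAngle]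

theorem helixPoint_add (n : ℕ) (t k : ℤ) :
    helixPoint n (t + k) = screwBy (2 * π * k / n) (helixPoint n t) := by
  rw [helixPoint, helixPoint, screwBy_helix]
  congr 1
  push_cast
  ring

theorem helixPoint_injective {n : ℕ} (hn : 1 ≤ n) : Function.Injective (helixPoint n) := by
  intro i j h
  have h0 := congrArg (fun p : E3 => p 0) h
  have hn0 : (n : ℝ) ≠ 0 := by positivity
  have hp := Real.pi_ne_zero
  simp only [helixPoint, helix_apply_zero] at h0
  field_simp at h0
  exact_mod_cast h0

theorem mem_helixRegion {n : ℕ} {t : ℤ} {x : E3} :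
    x ∈ helixRegion n t ↔ ∀ k, dist x (helixPoint n t) ≤ dist x (helixPoint n k) := by
  simp [helixRegion, voronoiRegion]

theorem screwBy_image_helixRegion (n : ℕ) (t k : ℤ) :
    screwBy (2 * π * k / n) '' helixRegion n t = helixRegion n (t + k) := by
  have key : ∀ (x : E3) (s : ℤ),
      dist (screwBy (-(2 * π * k / n)) x) (helixPoint n s) = dist x (helixPoint n (s + k)) := by
    intro x s
    rw [helixPoint_add, ← (isometry_screwBy (2 * π * k / n)).dist_eq, screwBy_screwBy,
      add_neg_cancel, screwBy_zero]
  ext x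
  simp only [mem_screwBy_image_iff, mem_helixRegion, key]
  exact ⟨fun h s => by simpa using h (s - k), fun h s => h (s + k)⟩

theorem screwBy_image_halfspace (φ a R : ℝ) :
    screwBy φ '' {p : E3 | p 1 * Real.cos a + p 2 * Real.sin a ≤ R} =
      {p : E3 | p 1 * Real.cos (a + φ) + p 2 * Real.sin (a + φ) ≤ R} := by
  ext x
  simp only [mem_screwBy_image_iff, Set.mem_ofPred_eq, screwBy_apply_one, screwBy_apply_two,
    Real.cos_neg, Real.sin_neg, Real.cos_add, Real.sin_add]
  ring_nf

theorem screwBy_image_clipHalfspace (n : ℕ) (t k : ℤ) :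
    screwBy (2 * π * k / n) '' clipHalfspace n t = clipHalfspace n (t + k) := by
  rw [clipHalfspace, screwBy_image_halfspace, clipHalfspace]
  congr! 6 <;> push_cast <;> ring

theorem screwBy_image_clippedRegion (n : ℕ) (t k : ℤ) :
    screwBy (2 * π * k / n) '' clippedRegion n t = clippedRegion n (t + k) := by
  rw [clippedRegion, Set.image_inter (isometry_screwBy _).injective,
    screwBy_image_helixRegion, screwBy_image_clipHalfspace, clippedRegion]

/-- The prism over a regular `n`-gon with inradius `R`. -/
noncomputable def prism (n : ℕ) (R : ℝ) : Set E3 :=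
  {p | ∀ k : ℤ, p 1 * Real.cos (2 * π * k / n) + p 2 * Real.sin (2 * π * k / n) ≤ R}

theorem screwBy_image_prism (n : ℕ) (R : ℝ) (k : ℤ) :
    screwBy (2 * π * k / n) '' prism n R = prism n R := by
  have key : ∀ (x : E3) (s : ℤ), screwBy (-(2 * π * k / n)) x 1 * Real.cos (2 * π * s / n) +
      screwBy (-(2 * π * k / n)) x 2 * Real.sin (2 * π * s / n) =
      x 1 * Real.cos (2 * π * (s + k : ℤ) / n) + x 2 * Real.sin (2 * π * (s + k : ℤ) / n) := by
    intro x s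
    have : 2 * π * (s + k : ℤ) / n = 2 * π * s / n + 2 * π * k / n := by push_cast; ring
    rw [this]
    simp only [screwBy_apply_one, screwBy_apply_two, Real.cos_neg, Real.sin_neg, Real.cos_add,
      Real.sin_add]
    ring
  ext x
  simp only [mem_screwBy_image_iff, prism, Set.mem_ofPred_eq, key]
  exact ⟨fun h s => by simpa using h (s - k), fun h s => h (s + k)⟩

theorem isPolyhedral_halfspace (a R : ℝ) :
    IsPolyhedral {p : E3 | p 1 * Real.cos a + p 2 * Real.sin a ≤ R} :=
  ⟨{(!₂[0, Real.cos a, Real.sin a], R)}, Set.finite_singleton _, by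
    simp [PiLp.inner_apply, Fin.sum_univ_three, mul_comm]⟩

theorem isPolyhedral_prism {n : ℕ} (hn : 1 ≤ n) (R : ℝ) : IsPolyhedral (prism n R) := by
  refine ⟨(fun k : ℤ => ((!₂[0, Real.cos (2 * π * k / n), Real.sin (2 * π * k / n)] : E3), R)) ''
    (Set.Ico 0 (n : ℤ)), (Set.finite_Ico _ _).image _, ?_⟩
  ext x
  simp only [prism, Set.mem_ofPred_eq, Set.forall_mem_image, PiLp.inner_apply, Fin.sum_univ_three]
  have hn0 : (n : ℝ) ≠ 0 := by positivity
  have hn0' : (n : ℤ) ≠ 0 := by positivity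
  constructor
  · intro h k _
    simpa [mul_comm] using h k
  · intro h k
    have h1 := h ⟨Int.emod_nonneg k hn0', Int.emod_lt_of_pos k (by positivity)⟩
    -- The constraints depend only on k mod n, so n of them suffice.
    have h2 : 2 * π * k / n = 2 * π * (k % n : ℤ) / n + (k / n : ℤ) * (2 * π) := by
      have h3 : (k : ℝ) = (k % n : ℤ) + (n : ℝ) * (k / n : ℤ) := by
        exact_mod_cast (Int.emod_add_mul_ediv k n).symm
      rw [h3]
      field_simp
    rw [h2, Real.cos_add_int_mul_two_pi, Real.sin_add_int_mul_two_pi]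
    simpa [mul_comm] using h1

theorem mul_cos_add_mul_sin_le {x y R : ℝ} (hR : 0 ≤ R) (h : x ^ 2 + y ^ 2 ≤ R ^ 2) (a : ℝ) :
    x * Real.cos a + y * Real.sin a ≤ R := by
  apply (abs_le_of_sq_le_sq' _ hR).2
  nlinarith [sq_nonneg (x * Real.sin a - y * Real.cos a), Real.sin_sq_add_cos_sq a]

theorem prism_mem_nhds {n : ℕ} {R : ℝ} (hR : 0 ≤ R) {c : E3}
    (hc : c 1 ^ 2 + c 2 ^ 2 < R ^ 2) : prism n R ∈ nhds c := by
  have hopen : IsOpen {p : E3 | p 1 ^ 2 + p 2 ^ 2 < R ^ 2} :=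
    isOpen_lt (by fun_prop) continuous_const
  exact Filter.mem_of_superset (hopen.mem_nhds hc) fun p hp k =>
    mul_cos_add_mul_sin_le hR (le_of_lt hp) _

theorem halfspace_mem_nhds {a R : ℝ} {c : E3}
    (hc : c 1 * Real.cos a + c 2 * Real.sin a < R) :
    {p : E3 | p 1 * Real.cos a + p 2 * Real.sin a ≤ R} ∈ nhds c := by
  have hopen : IsOpen {p : E3 | p 1 * Real.cos a + p 2 * Real.sin a < R} :=
    isOpen_lt (by fun_prop) continuous_const
  exact Filter.mem_of_superset (hopen.mem_nhds hc) fun x hx => le_of_lt (Set.mem_ofPred_eq ▸ hx)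

/-! ### Voronoi regions of the helix points -/

theorem finite_helixPoint_dist_le {n : ℕ} (hn : 1 ≤ n) (c : E3) (r : ℝ) :
    {k : ℤ | dist c (helixPoint n k) ≤ r}.Finite := by
  have hn0 : (0 : ℝ) < n := by positivity
  have hp := Real.pi_pos
  refine (Set.finite_Icc ⌊(c 0 - r) * n / (2 * π)⌋ ⌈(c 0 + r) * n / (2 * π)⌉).subset fun k hk => ?_
  have h := abs_le.1 ((abs_coord_zero_sub_le_dist c (helixPoint n k)).trans hk)
  have hk0 : helixPoint n k 0 = k * (2 * π / n) := by
    rw [helixPoint, helix_apply_zero]; ring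
  rw [hk0] at h
  have hinv : ∀ y : ℝ, y * n / (2 * π) = y / (2 * π / n) := fun y => by field_simp
  have hθ : 0 < 2 * π / n := by positivity
  constructor
  · apply Int.floor_le_iff.2
    rw [hinv, div_lt_iff₀ hθ]
    linarith
  · apply Int.le_ceil_iff.2
    rw [hinv, lt_div_iff₀ hθ]
    linarith

theorem eventually_dist_le_helixPoint {n : ℕ} (hn : 1 ≤ n) {c p : E3} {S : Set ℤ}
    (h : ∀ k ∈ S, dist c p < dist c (helixPoint n k)) :
    ∀ᶠ x in nhds c, ∀ k ∈ S, dist x p ≤ dist x (helixPoint n k) := by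
  -- The margin 2 pays for moving x by less than 1 in both distances; sites beyond it impose nothing
  -- on the unit ball around `c`.
  have hfin := finite_helixPoint_dist_le hn c (dist c p + 2)
  have h1 : ∀ᶠ x in nhds c, ∀ k ∈ {k : ℤ | dist c (helixPoint n k) ≤ dist c p + 2},
      k ∈ S → dist x p ≤ dist x (helixPoint n k) := by
    rw [Filter.eventually_all_finite hfin]
    intro k _
    by_cases hk : k ∈ S
    · have hc : ContinuousAt (fun x => dist x p) c := by fun_prop
      have := hc.eventually_lt (g := fun x => dist x (helixPoint n k)) (by fun_prop) (h k hk)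
      exact this.mono fun x hx _ => hx.le
    · exact Filter.Eventually.of_forall fun x hx => absurd hx hk
  filter_upwards [h1, Metric.ball_mem_nhds c one_pos] with x hx hball k hk
  by_cases hkd : dist c (helixPoint n k) ≤ dist c p + 2
  · exact hx k hkd hk
  · have h2 := dist_triangle x c p
    have h3 := dist_triangle c x (helixPoint n k)
    rw [dist_comm c x] at h3
    rw [Metric.mem_ball] at hball
    linarith

theorem helixRegion_mem_nhds {n : ℕ} (hn : 1 ≤ n) (t : ℤ) :
    helixRegion n t ∈ nhds (helixPoint n t) := by
  have h := eventually_dist_le_helixPoint hn (c := helixPoint n t) (p := helixPoint n t)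
    (S := {k | k ≠ t}) fun k hk => by
      rw [dist_self, dist_pos]
      exact (helixPoint_injective hn).ne (Ne.symm hk)
  filter_upwards [h] with x hx
  rw [mem_helixRegion]
  intro k
  by_cases hk : k = t
  · rw [hk]
  · exact hx k hk

theorem dist_sq_helix_add (x : E3) (a s : ℝ) :
    dist x (helix (a + s)) ^ 2 = (x 0 - a - s) ^ 2 + x 1 ^ 2 + x 2 ^ 2 + 1 -
      2 * ((x 1 * Real.cos a + x 2 * Real.sin a) * Real.cos s +
        (x 2 * Real.cos a - x 1 * Real.sin a) * Real.sin s) := by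
  rw [dist_sq_eq_coord, helix_apply_zero, helix_apply_one, helix_apply_two, Real.cos_add,
    Real.sin_add]
  have h1 := Real.sin_sq_add_cos_sq a
  have h2 := Real.sin_sq_add_cos_sq s
  linear_combination (Real.sin s ^ 2 + Real.cos s ^ 2) * h1 + h2

/-- In coordinates rotated with the site, s = ±2π bounds the axial offset X by π, and adding the
inequalities for s = ±θ bounds the radial coordinate w from below. With w ≤ R given, each of the two
then bounds the remaining coordinate z from one side. -/
theorem isBounded_of_dist_le_helix {a θ R : ℝ} (hθ : 0 < θ) (hθπ : θ < π) {A : Set E3}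
    (hR : ∀ x ∈ A, x 1 * Real.cos a + x 2 * Real.sin a ≤ R)
    (h : ∀ x ∈ A, ∀ s ∈ ({θ, -θ, 2 * π, -(2 * π)} : Set ℝ),
      dist x (helix a) ≤ dist x (helix (a + s))) :
    Bornology.IsBounded A := by
  have hp := Real.pi_pos
  have hsin : 0 < Real.sin θ := Real.sin_pos_of_pos_of_lt_pi hθ hθπ
  have hcos : 0 < 1 - Real.cos θ := by
    have := Real.cos_lt_cos_of_nonneg_of_le_pi le_rfl hθπ.le hθ
    rw [Real.cos_zero] at this
    linarith
  set W := |R| + θ ^ 2 / (2 * (1 - Real.cos θ)) with hW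
  set Z := (θ ^ 2 / 2 + π * θ + |R| * (1 - Real.cos θ)) / Real.sin θ with hZ
  refine (Metric.isBounded_closedBall (x := helix a)
    (r := |π| + (W + 1) + Z)).subset fun x hx => ?_
  have hs : ∀ s ∈ ({θ, -θ, 2 * π, -(2 * π)} : Set ℝ), 0 ≤ s ^ 2 - 2 * (x 0 - a) * s -
      2 * ((x 1 * Real.cos a + x 2 * Real.sin a) * (Real.cos s - 1) +
        (x 2 * Real.cos a - x 1 * Real.sin a) * Real.sin s) := by
    intro s hs
    have h1 := h x hx s hs
    rw [← sq_le_sq₀ dist_nonneg dist_nonneg, dist_sq_helix_add] at h1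
    have h2 := dist_sq_helix_add x a 0
    simp only [add_zero, Real.cos_zero, Real.sin_zero] at h2
    rw [h2] at h1
    linarith
  have hw := hR x hx
  have hd := dist_sq_helix_add x a 0
  have hrot : x 1 ^ 2 + x 2 ^ 2 = (x 1 * Real.cos a + x 2 * Real.sin a) ^ 2 +
      (x 2 * Real.cos a - x 1 * Real.sin a) ^ 2 := by
    linear_combination -(x 1 ^ 2 + x 2 ^ 2) * Real.sin_sq_add_cos_sq a
  simp only [add_zero, Real.cos_zero, Real.sin_zero, add_assoc] at hd
  simp only [Set.mem_insert_iff, Set.mem_singleton_iff, forall_eq_or_imp, forall_eq,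
    Real.cos_neg, Real.sin_neg, Real.cos_two_pi, Real.sin_two_pi] at hs
  generalize x 1 * Real.cos a + x 2 * Real.sin a = w at *
  generalize x 2 * Real.cos a - x 1 * Real.sin a = z at *
  generalize x 0 - a = X at *
  obtain ⟨h1, h2, h3, h4⟩ := hs
  have hX : |X| ≤ π := by
    rw [abs_le]
    constructor <;> nlinarith
  have hX' := abs_le.1 hX
  have hR' := le_abs_self R
  have hR0 := abs_nonneg R
  have hw1 : -(θ ^ 2 / (2 * (1 - Real.cos θ))) ≤ w := by
    rw [neg_le, le_div_iff₀ (by linarith)]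
    nlinarith
  have hwW : |w| ≤ W := by
    rw [abs_le]
    have : 0 ≤ θ ^ 2 / (2 * (1 - Real.cos θ)) := by positivity
    constructor <;> linarith
  have hwR : w * (1 - Real.cos θ) ≤ |R| * (1 - Real.cos θ) := by
    gcongr
    linarith
  have hXθ : X * θ ≤ π * θ := by gcongr; exact hX'.2
  have hXθ' : -(X * θ) ≤ π * θ := by nlinarith
  have hzZ : |z| ≤ Z := by
    have habs : |z| * Real.sin θ = |z * Real.sin θ| := by rw [abs_mul, abs_of_pos hsin]
    rw [hZ, le_div_iff₀ hsin, habs, abs_le]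
    constructor <;> linarith
  rw [Metric.mem_closedBall]
  have hw2 : |w - 1| ≤ W + 1 := (abs_sub w 1).trans (by rw [abs_one]; linarith)
  refine abs_le_of_sq_le_sq ?_ (by positivity) |> (le_abs_self _).trans
  have e1 : X ^ 2 ≤ |π| ^ 2 := by rw [sq_le_sq, abs_abs, abs_of_pos hp]; exact hX
  have e2 : (w - 1) ^ 2 ≤ (W + 1) ^ 2 := by
    rw [← sq_abs]; gcongr
  have e3 : z ^ 2 ≤ Z ^ 2 := by
    rw [← sq_abs]; gcongr
  have hW0 := (abs_nonneg _).trans hw2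
  have hZ0 := (abs_nonneg _).trans hzZ
  have hp0 := abs_nonneg π
  nlinarith [mul_nonneg hW0 hZ0, mul_nonneg hp0 hZ0, mul_nonneg hp0 hW0]

theorem isPolyhedral_forall_dist_le (n : ℕ) (t : ℤ) {T : Set ℤ} (hT : T.Finite) :
    IsPolyhedral {x | ∀ k ∈ T, dist x (helixPoint n t) ≤ dist x (helixPoint n k)} := by
  induction T, hT using Set.Finite.induction_on with
  | empty => exact ⟨∅, Set.finite_empty, by simp⟩
  | @insert k T _ _ ih =>
    convert (isPolyhedral_dist_le_dist (helixPoint n t) (helixPoint n k)).inter ih using 1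
    ext x
    simp

/-- Four sites already confine the cell to a ball of radius M around its own site. Sites farther
than 2M from that site cut nothing off, so finitely many halfspaces remain. -/
theorem isConvexPolytope3_helixRegion_inter {n : ℕ} (hn : 3 ≤ n) (t : ℤ) {C : Set E3} {R : ℝ}
    (hC : IsPolyhedral C) (hCn : C ∈ nhds (helixPoint n t))
    (hR : ∀ x ∈ C, x 1 * Real.cos (2 * π * t / n) + x 2 * Real.sin (2 * π * t / n) ≤ R) :
    IsConvexPolytope3 (helixRegion n t ∩ C) := by
  have hp := Real.pi_pos
  have hn3 : (3 : ℝ) ≤ n := by exact_mod_cast hn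
  have hn0 : (0 : ℝ) < n := by linarith
  set D : Set ℤ → Set E3 := fun T =>
    {x | ∀ k ∈ T, dist x (helixPoint n t) ≤ dist x (helixPoint n k)} with hD
  set T₀ : Set ℤ := {t + 1, t - 1, t + n, t - n} with hT₀
  have hb : Bornology.IsBounded (D T₀ ∩ C) := by
    apply isBounded_of_dist_le_helix (a := 2 * π * t / n) (θ := 2 * π / n) (R := R)
    · positivity
    · rw [div_lt_iff₀ hn0]; nlinarith
    · exact fun x hx => hR x hx.2
    · intro x hx
      have hx1 := hx.1
      simp only [hD, hT₀, Set.mem_ofPred_eq, Set.mem_insert_iff, Set.mem_singleton_iff,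
        forall_eq_or_imp, forall_eq] at hx1 ⊢
      obtain ⟨h1, h2, h3, h4⟩ := hx1
      simp only [helixPoint] at h1 h2 h3 h4
      refine ⟨?_, ?_, ?_, ?_⟩
      · convert h1 using 3; push_cast; ring
      · convert h2 using 3; push_cast; ring
      · convert h3 using 3; push_cast; field_simp
      · convert h4 using 3; push_cast; field_simp; ring
  obtain ⟨M, hM⟩ := hb.subset_closedBall (helixPoint n t)
  set T₁ : Set ℤ := {k | dist (helixPoint n t) (helixPoint n k) ≤ 2 * M} with hT₁
  have hT₁fin : T₁.Finite := finite_helixPoint_dist_le (by lia) _ _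
  have hT₀fin : T₀.Finite := by simp [hT₀]
  have heq : helixRegion n t ∩ C = D (T₀ ∪ T₁) ∩ C := by
    ext x
    refine and_congr_left fun hxC => ?_
    rw [mem_helixRegion]
    refine ⟨fun h k _ => h k, fun h k => ?_⟩
    by_cases hk : k ∈ T₁
    · exact h k (Or.inr hk)
    · have h1 : x ∈ Metric.closedBall (helixPoint n t) M :=
        hM ⟨fun k hk => h k (Or.inl hk), hxC⟩
      rw [Metric.mem_closedBall] at h1
      have h2 : 2 * M < dist (helixPoint n t) (helixPoint n k) := not_le.1 hk
      have h3 := dist_triangle (helixPoint n t) x (helixPoint n k)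
      rw [dist_comm _ x] at h3
      linarith
  refine ⟨?_, setDim_eq_three (Filter.inter_mem (helixRegion_mem_nhds (by lia) t) hCn)⟩
  rw [heq]
  refine ((isPolyhedral_forall_dist_le n t (hT₀fin.union hT₁fin)).inter hC).exists_eq_convexHull
    (hb.subset ?_)
  exact Set.inter_subset_inter_left _ fun x hx k hk => hx k (Or.inl hk)

theorem isConvexPolytope3_clippedRegion {n : ℕ} (hn : 3 ≤ n) (t : ℤ) :
    IsConvexPolytope3 (clippedRegion n t) := by
  refine isConvexPolytope3_helixRegion_inter hn t (R := n) (isPolyhedral_halfspace _ _) ?_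
    fun x hx => hx
  apply halfspace_mem_nhds
  have hn3 : (3 : ℝ) ≤ n := by exact_mod_cast hn
  simp only [helixPoint, helix_apply_one, helix_apply_two]
  nlinarith [Real.sin_sq_add_cos_sq (2 * π * t / n)]

theorem isConvexPolytope3_helixRegion_inter_prism {n : ℕ} (hn : 3 ≤ n) (t : ℤ) {R : ℝ}
    (hR : 1 < R) : IsConvexPolytope3 (helixRegion n t ∩ prism n R) := by
  refine isConvexPolytope3_helixRegion_inter hn t (R := R) (isPolyhedral_prism (by lia) R) ?_
    fun x hx => hx t
  apply prism_mem_nhds (by linarith)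
  simp only [helixPoint, helix_apply_one, helix_apply_two]
  nlinarith [Real.sin_sq_add_cos_sq (2 * π * t / n)]

/-! ### Common facets -/

/-- A parameter `R` such that, among the points `h(πe/n)` with `e ≡ d` mod `2`, those with
`e = ±d` are the closest to `(0, -R, 0)`. -/
theorem exists_sq_add_cos_lt {n : ℕ} {d : ℤ} (hd : 1 ≤ d) (hdn : d ≤ n) :
    ∃ R : ℝ, -R * Real.cos (π * d / n) < max (n : ℝ) 3 ∧
      ∀ e : ℤ, 2 ∣ e - d → |e| ≠ d →
        (π * d / n) ^ 2 + 2 * R * Real.cos (π * d / n) <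
          (π * e / n) ^ 2 + 2 * R * Real.cos (π * e / n) := by
  have hp := Real.pi_pos
  have hd0 : (1 : ℝ) ≤ d := by exact_mod_cast hd
  have hn0 : (0 : ℝ) < n := by exact_mod_cast (by lia : (0 : ℤ) < n)
  have hm3 : (3 : ℝ) ≤ max (n : ℝ) 3 := le_max_right _ _
  have hmn : (n : ℝ) ≤ max (n : ℝ) 3 := le_max_left _ _
  rcases hdn.lt_or_eq with hlt | rfl
  · set t := π * d / n with ht
    have hdn1 : (d : ℝ) + 1 ≤ n := by exact_mod_cast hlt
    have ht0 : 0 < t := by positivity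
    have htπ : t < π := by rw [ht, div_lt_iff₀ hn0]; nlinarith
    have hsin := Real.sin_pos_of_pos_of_lt_pi ht0 htπ
    refine ⟨t / Real.sin t, ?_, fun e _ he => ?_⟩
    · refine lt_of_lt_of_le ?_ hmn
      rw [neg_mul, div_mul_eq_mul_div, ← neg_div, div_lt_iff₀ hsin]
      rcases le_or_gt t (π / 2) with h | h
      · have := Real.cos_nonneg_of_mem_Icc ⟨by linarith, h⟩
        nlinarith [mul_pos hn0 hsin, mul_nonneg ht0.le this]
      · clear_value t
        obtain ⟨u, rfl⟩ : ∃ u, t = π - u := ⟨π - t, by ring⟩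
        have hu0 : 0 < u := by linarith
        have hu := mul_cos_lt_mul_sin hu0 (by linarith)
        have hc := Real.cos_pos_of_mem_Ioo ⟨by linarith, (by linarith : u < π / 2)⟩
        rw [Real.sin_pi_sub] at hsin ⊢
        rw [Real.cos_pi_sub]
        -- Here d ≤ n - 1 is used: t stays at least π/n away from π.
        have hnu : π ≤ n * u := by
          have : n * (π - u) = π * d := by rw [ht]; field_simp
          nlinarith
        have h1 : u * ((π - u) * Real.cos u) < u * (n * Real.sin u) := by
          calc u * ((π - u) * Real.cos u) = (π - u) * (u * Real.cos u) := by ring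
            _ ≤ π * (u * Real.cos u) := by gcongr
            _ < π * Real.sin u := by gcongr
            _ ≤ n * u * Real.sin u := by gcongr
            _ = _ := by ring
        have := lt_of_mul_lt_mul_left h1 hu0.le
        linarith
    · apply sq_add_cos_lt_of_abs_ne ht0 htπ (div_mul_cancel₀ _ hsin.ne')
      intro h
      apply he
      rw [ht, abs_div, abs_mul, abs_of_pos hp, abs_of_pos hn0] at h
      field_simp at h
      exact_mod_cast h
  · have hs : π * ((n : ℤ) : ℝ) / n = π := by push_cast; field_simp
    rw [hs, Real.cos_pi]
    set m : ℝ := max (n : ℝ) 3 with hm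
    -- The finitely many strict inequalities at R = m persist for R just below m, which leaves the
    -- centre strictly inside the clipping halfspace.
    have hev : ∀ᶠ R : ℝ in nhdsWithin m (Set.Iio m), ∀ e ∈ Set.Icc (-(n - 2) : ℤ) (n - 2),
        π ^ 2 + 2 * R * (-1) < (π * e / n) ^ 2 + 2 * R * Real.cos (π * e / n) := by
      rw [Filter.eventually_all_finite (Set.finite_Icc _ _)]
      intro e he
      have hc : ContinuousAt (fun R : ℝ => π ^ 2 + 2 * R * (-1)) m := by fun_prop
      refine (hc.eventually_lt (g := fun R => (π * e / n) ^ 2 + 2 * R * Real.cos (π * e / n))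
        (by fun_prop) ?_).filter_mono nhdsWithin_le_nhds
      have he' : (|e| : ℝ) ≤ n - 2 := by exact_mod_cast (abs_le.2 he : |e| ≤ (n : ℤ) - 2)
      have habs : |π * (e : ℝ) / n| = π * |(e : ℝ)| / n := by
        rw [abs_div, abs_mul, abs_of_pos hp, abs_of_pos hn0]
      rw [← sq_abs (π * e / n), ← Real.cos_abs (π * e / n)]
      have := pi_sq_sub_lt_sq_add_cos hm3 (abs_nonneg (π * (e : ℝ) / n)) <| by
        rw [habs]
        calc π * |(e : ℝ)| / n ≤ π * (n - 2) / n := by gcongr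
          _ = π - 2 * π / n := by field_simp
          _ ≤ π - 2 * π / m := by gcongr
      linarith
    have hm0 : 0 < m := by linarith
    obtain ⟨R, ⟨hR, hRm⟩, hR0⟩ := ((hev.and self_mem_nhdsWithin).and
      ((eventually_gt_nhds hm0).filter_mono nhdsWithin_le_nhds)).exists
    have hRm : R < m := hRm
    refine ⟨R, by linarith, fun e hdvd he => ?_⟩
    by_cases hle : |e| ≤ n - 2
    · exact hR e (abs_le.1 hle)
    -- Parity excludes |e| = n - 1, and |e| = n is excluded by assumption.
    · have he1 : (n : ℤ) + 1 ≤ |e| := by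
        have h1 : (n : ℤ) - 2 < |e| := not_le.1 hle
        rcases abs_cases e with ⟨h, _⟩ | ⟨h, _⟩ <;> rw [h] at h1 he ⊢ <;> lia
      have he2 : (n : ℝ) + 1 ≤ |(e : ℝ)| := by exact_mod_cast he1
      have h1 : π < |π * (e : ℝ) / n| := by
        rw [abs_div, abs_mul, abs_of_pos hp, abs_of_pos hn0, lt_div_iff₀ hn0]
        nlinarith
      have h2 : π ^ 2 < (π * e / n) ^ 2 := by
        rw [← sq_abs (π * e / n)]; gcongr
      nlinarith [Real.neg_one_le_cos (π * e / n)]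

theorem dist_sq_axis_helix (α R s : ℝ) :
    dist (!₂[α, -R * Real.cos α, -R * Real.sin α] : E3) (helix (α + s)) ^ 2 =
      s ^ 2 + 2 * R * Real.cos s + (R ^ 2 + 1) := by
  rw [dist_sq_helix_add]
  simp only [Matrix.cons_val]
  linear_combination (R ^ 2 + 2 * R * Real.cos s) * Real.sin_sq_add_cos_sq α

theorem axis_mul_cos_add_mul_sin (α R s : ℝ) :
    (!₂[α, -R * Real.cos α, -R * Real.sin α] : E3) 1 * Real.cos (α + s) +
      (!₂[α, -R * Real.cos α, -R * Real.sin α] : E3) 2 * Real.sin (α + s) =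
      -R * Real.cos s := by
  simp only [Matrix.cons_val, Real.cos_add, Real.sin_add]
  linear_combination (-R * Real.cos s) * Real.sin_sq_add_cos_sq α

/-- `c` has the two points `h_n(i)` and `h_n(j)` as its nearest points among all `h_n(k)`. -/
def IsFacetCenter (n : ℕ) (i j : ℤ) (c : E3) : Prop :=
  dist c (helixPoint n i) = dist c (helixPoint n j) ∧
    ∀ k, k ≠ i → k ≠ j → dist c (helixPoint n i) < dist c (helixPoint n k)

theorem IsFacetCenter.symm {n : ℕ} {i j : ℤ} {c : E3} (h : IsFacetCenter n i j c) :
    IsFacetCenter n j i c :=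
  ⟨h.1.symm, fun k hj hi => h.1 ▸ h.2 k hi hj⟩

/-- Relative to the mean parameter α, site k has offset πe/n with e = 2k - i - j, so i and j
correspond to e = ∓(j - i) and all e share one parity. -/
theorem exists_isFacetCenter_of_lt {n : ℕ} {i j : ℤ} (hij : i < j) (hj : j ≤ i + n) :
    ∃ c : E3, IsFacetCenter n i j c ∧
      c 1 * Real.cos (2 * π * i / n) + c 2 * Real.sin (2 * π * i / n) < max (n : ℝ) 3 ∧
      c 1 * Real.cos (2 * π * j / n) + c 2 * Real.sin (2 * π * j / n) < max (n : ℝ) 3 := by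
  obtain ⟨R, hR, hlt⟩ := exists_sq_add_cos_lt (n := n) (d := j - i) (by lia) (by lia)
  set α : ℝ := π * (i + j) / n with hα
  set t : ℝ := π * (j - i : ℤ) / n with ht
  have hpt : ∀ k : ℤ, 2 * π * k / n = α + π * (2 * k - i - j : ℤ) / n := by
    intro k
    rw [hα]
    push_cast
    ring
  have hi' : α + π * (2 * i - i - j : ℤ) / n = α + -t := by rw [ht]; push_cast; ring
  have hj' : α + π * (2 * j - i - j : ℤ) / n = α + t := by rw [ht]; push_cast; ring
  refine ⟨!₂[α, -R * Real.cos α, -R * Real.sin α], ⟨?_, fun k hki hkj => ?_⟩, ?_, ?_⟩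
  · rw [← sq_eq_sq₀ dist_nonneg dist_nonneg, helixPoint, helixPoint, hpt i, hpt j, hi', hj',
      dist_sq_axis_helix, dist_sq_axis_helix, Real.cos_neg, neg_sq]
  · rw [← sq_lt_sq₀ dist_nonneg dist_nonneg, helixPoint, helixPoint, hpt i, hpt k, hi',
      dist_sq_axis_helix, dist_sq_axis_helix, Real.cos_neg, neg_sq]
    have := hlt (2 * k - i - j) ⟨k - j, by ring⟩ (fun h => by
      rcases abs_cases (2 * k - i - j) with ⟨h1, _⟩ | ⟨h1, _⟩ <;> lia)
    linarith
  · rwa [hpt i, hi', axis_mul_cos_add_mul_sin, Real.cos_neg]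
  · rwa [hpt j, hj', axis_mul_cos_add_mul_sin]

theorem exists_isFacetCenter {n : ℕ} {i j : ℤ} (hij : i ≠ j) (h : |i - j| ≤ n) :
    ∃ c : E3, IsFacetCenter n i j c ∧
      c 1 * Real.cos (2 * π * i / n) + c 2 * Real.sin (2 * π * i / n) < max (n : ℝ) 3 ∧
      c 1 * Real.cos (2 * π * j / n) + c 2 * Real.sin (2 * π * j / n) < max (n : ℝ) 3 := by
  rw [abs_le] at h
  rcases lt_or_gt_of_ne hij with hlt | hlt
  · exact exists_isFacetCenter_of_lt hlt (by lia)
  · obtain ⟨c, hc, hi, hj⟩ := exists_isFacetCenter_of_lt (n := n) hlt (by lia)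
    exact ⟨c, hc.symm, hj, hi⟩

/-- Near `c` no third site competes, so there the bisector plane is the common boundary; any `C`
that is a neighbourhood of `c` leaves a disc of it. -/
theorem IsFacetCenter.setDim_inter {n : ℕ} (hn : 1 ≤ n) {i j : ℤ} (hij : i ≠ j) {c : E3}
    (hc : IsFacetCenter n i j c) {C : Set E3} (hC : C ∈ nhds c) :
    setDim (helixRegion n i ∩ helixRegion n j ∩ C) = 2 := by
  have hev := eventually_dist_le_helixPoint hn (S := {k | k ≠ i ∧ k ≠ j})
    fun k hk => hc.2 k hk.1 hk.2
  refine setDim_eq_two ((helixPoint_injective hn).ne hij) hc.1 (fun x hx => ?_)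
    (Filter.inter_mem hev hC) fun x hx hxe => ?_
  · exact le_antisymm (mem_helixRegion.1 hx.1.1 j) (mem_helixRegion.1 hx.1.2 i)
  · have hall : ∀ k, dist x (helixPoint n i) ≤ dist x (helixPoint n k) := by
      intro k
      by_cases hki : k = i
      · rw [hki]
      by_cases hkj : k = j
      · rw [hkj, hxe]
      exact hx.1 k ⟨hki, hkj⟩
    exact ⟨⟨mem_helixRegion.2 hall, mem_helixRegion.2 fun k => hxe ▸ hall k⟩, hx.2⟩

theorem isExposed_helixRegion_inter (n : ℕ) (i j : ℤ) (C : Set E3) :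
    IsExposed ℝ (helixRegion n i ∩ C) (helixRegion n i ∩ helixRegion n j ∩ C) := by
  refine isExposed_dist_eq_dist (p := helixPoint n i) (q := helixPoint n j)
    (fun x hx => mem_helixRegion.1 hx.1 j) ?_
  ext x
  simp only [Set.mem_inter_iff, Set.mem_ofPred_eq, mem_helixRegion]
  constructor
  · rintro ⟨⟨hi, hj⟩, hC⟩
    exact ⟨⟨hi, hC⟩, le_antisymm (hi j) (hj i)⟩
  · rintro ⟨⟨hi, hC⟩, he⟩
    exact ⟨⟨hi, fun k => he ▸ hi k⟩, hC⟩

theorem IsFacetCenter.isFacet_left {n : ℕ} (hn : 1 ≤ n) {i j : ℤ} (hij : i ≠ j) {c : E3}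
    (hc : IsFacetCenter n i j c) {C : Set E3} (hC : C ∈ nhds c) :
    IsFacet ((helixRegion n i ∩ C) ∩ (helixRegion n j ∩ C)) (helixRegion n i ∩ C) := by
  rw [← Set.inter_inter_distrib_right]
  exact ⟨isExposed_helixRegion_inter n i j C, hc.setDim_inter hn hij hC⟩

theorem IsFacetCenter.isFacet_right {n : ℕ} (hn : 1 ≤ n) {i j : ℤ} (hij : i ≠ j) {c : E3}
    (hc : IsFacetCenter n i j c) {C : Set E3} (hC : C ∈ nhds c) :
    IsFacet ((helixRegion n i ∩ C) ∩ (helixRegion n j ∩ C)) (helixRegion n j ∩ C) := by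
  rw [Set.inter_comm]
  exact hc.symm.isFacet_left hn hij.symm hC

theorem abs_add_natCast_sub_le {n : ℕ} (a : ℤ) (i j : Fin (n + 1)) :
    |(a + (i : ℕ)) - (a + (j : ℕ))| ≤ (n : ℤ) := by
  rw [abs_le]
  have := i.2
  have := j.2
  constructor <;> lia

theorem add_natCast_ne {n : ℕ} (a : ℤ) {i j : Fin n} (h : i ≠ j) :
    a + (i : ℕ) ≠ a + (j : ℕ) := fun he => h (Fin.ext (by lia))

theorem meetInCommonFacets_helixRegion {n : ℕ} (hn : 1 ≤ n) (a : ℤ) :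
    MeetInCommonFacets fun i : Fin (n + 1) => helixRegion n (a + (i : ℕ)) := by
  intro i j hij
  have hne := add_natCast_ne a hij
  obtain ⟨c, hc, -⟩ := exists_isFacetCenter hne (abs_add_natCast_sub_le a i j)
  have hl := hc.isFacet_left hn hne (C := Set.univ) Filter.univ_mem
  have hr := hc.isFacet_right hn hne (C := Set.univ) Filter.univ_mem
  simp only [Set.inter_univ] at hl hr
  exact ⟨hl, hr⟩

theorem isNeighborly_clippedRegion {n : ℕ} (hn : 3 ≤ n) (a : ℤ) :
    IsNeighborly fun i : Fin (n + 1) => clippedRegion n (a + (i : ℕ)) := by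
  intro i j hij
  have hne := add_natCast_ne a hij
  obtain ⟨c, hc, hi, hj⟩ := exists_isFacetCenter hne (abs_add_natCast_sub_le a i j)
  have hmax : max (n : ℝ) 3 = n := max_eq_left (by exact_mod_cast hn)
  rw [hmax] at hi hj
  have := hc.setDim_inter (by lia) hne
    (Filter.inter_mem (halfspace_mem_nhds hi) (halfspace_mem_nhds hj))
  rwa [Set.inter_inter_inter_comm] at this

/-- A common clipping set makes the intersection of two clipped cells the full face of each on the
bisector plane. The prism is invariant under the screw motions, hence the congruence, and is chosen
wide enough to contain all the facet centres in its interior. -/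
theorem exists_neighborly_family (m : ℕ) :
    ∃ P : Fin m → Set E3, (∀ i, IsConvexPolytope3 (P i)) ∧ (∀ i j, AreCongruent (P i) (P j)) ∧
      IsNeighborly P ∧ MeetInCommonFacets P := by
  obtain ⟨n, hn3, hmn⟩ : ∃ n : ℕ, 3 ≤ n ∧ m ≤ n := ⟨max m 3, le_max_right _ _, le_max_left _ _⟩
  have hn : 1 ≤ n := by lia
  have hcen : ∀ i j : Fin m, ∃ c : E3, i ≠ j → IsFacetCenter n (i : ℕ) (j : ℕ) c := by
    intro i j
    by_cases hij : i = j
    -- A dummy centre on the diagonal, so that `c` is total.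
    · exact ⟨0, fun h => absurd hij h⟩
    · obtain ⟨c, hc, -⟩ := exists_isFacetCenter (n := n) (i := (i : ℕ)) (j := (j : ℕ))
        (by simpa [Fin.ext_iff] using hij)
        (by rw [abs_le]; have := i.2; have := j.2; constructor <;> lia)
      exact ⟨c, fun _ => hc⟩
  choose c hc using hcen
  obtain ⟨B, hB⟩ := (Set.finite_range fun ij : Fin m × Fin m =>
    c ij.1 ij.2 1 ^ 2 + c ij.1 ij.2 2 ^ 2).bddAbove
  set R : ℝ := |B| + 2 with hR
  have hR2 : 2 ≤ R := by linarith [abs_nonneg B]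
  have hnhds : ∀ i j, prism n R ∈ nhds (c i j) := by
    intro i j
    apply prism_mem_nhds (by linarith)
    have h1 := hB ⟨(i, j), rfl⟩
    have h2 := le_abs_self B
    simp only at h1
    nlinarith
  have hfacet : MeetInCommonFacets fun i : Fin m => helixRegion n (i : ℕ) ∩ prism n R := by
    intro i j hij
    have hne : ((i : ℕ) : ℤ) ≠ (j : ℕ) := by simpa [Fin.ext_iff] using hij
    exact ⟨(hc i j hij).isFacet_left hn hne (hnhds i j),
      (hc i j hij).isFacet_right hn hne (hnhds i j)⟩
  refine ⟨fun i => helixRegion n (i : ℕ) ∩ prism n R,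
    fun i => isConvexPolytope3_helixRegion_inter_prism hn3 _ (by linarith), fun i j => ?_,
    fun i j hij => (hfacet hij).1.2, hfacet⟩
  refine ⟨screwEquiv (2 * π * ((j : ℕ) - (i : ℕ) : ℤ) / n), ?_⟩
  change screwBy _ '' _ = _
  rw [Set.image_inter (isometry_screwBy _).injective, screwBy_image_helixRegion,
    screwBy_image_prism, add_sub_cancel]

/-! ### Bitangent spheres -/

theorem hasDerivAt_helix (t : ℝ) : HasDerivAt helix !₂[1, -Real.sin t, Real.cos t] t := by
  rw [← hasDerivWithinAt_univ, hasDerivWithinAt_iff_hasFDerivWithinAt, hasFDerivWithinAt_euclidean]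
  intro i
  rw [hasFDerivWithinAt_univ]
  fin_cases i
  · exact (hasDerivAt_id t).hasFDerivAt.congr_fderiv (by ext; simp)
  · exact (Real.hasDerivAt_cos t).hasFDerivAt.congr_fderiv (by ext; simp)
  · exact (Real.hasDerivAt_sin t).hasFDerivAt.congr_fderiv (by ext; simp)

/-- Tangency means that the radius is orthogonal to the velocity (1, -sin t, cos t). -/
theorem isTangentAt_helix_iff (S : EuclideanGeometry.Sphere E3) (t : ℝ) :
    S.IsTangentAt (helix t) (helixTangentLine t) ↔ dist (helix t) S.center = S.radius ∧
      t - S.center 0 + S.center 1 * Real.sin t - S.center 2 * Real.cos t = 0 := by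
  have hmem : helix t ∈ S ↔ dist (helix t) S.center = S.radius := EuclideanGeometry.mem_sphere
  have hle : helixTangentLine t ≤ S.orthRadius (helix t) ↔
      t - S.center 0 + S.center 1 * Real.sin t - S.center 2 * Real.cos t = 0 := by
    rw [helixTangentLine, EuclideanGeometry.Sphere.orthRadius, AffineSubspace.mk'_le_mk'_iff]
    rw [Submodule.span_singleton_le_iff_mem, Submodule.mem_orthogonal_singleton_iff_inner_right,
      (hasDerivAt_helix t).deriv]
    simp only [PiLp.inner_apply, Fin.sum_univ_three, vsub_eq_sub, PiLp.sub_apply,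
      helix_apply_zero, helix_apply_one, helix_apply_two, Matrix.cons_val,
      RCLike.inner_apply, conj_trivial]
    ring_nf
  exact ⟨fun h => ⟨hmem.1 h.mem_sphere, hle.1 h.le_orthRadius⟩,
    fun h => ⟨hmem.2 h.1, AffineSubspace.self_mem_mk' _ _, hle.2 h.2⟩⟩

theorem isBitangentSphere_iff {t : ℝ} (h0 : 0 < t) (h : t < π)
    (S : EuclideanGeometry.Sphere E3) : IsBitangentSphere S t ↔
      S.center = !₂[0, -(t / Real.sin t), 0] ∧ S.radius = dist (helix t) S.center := by
  have hsin := Real.sin_pos_of_pos_of_lt_pi h0 h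
  have hlt := mul_cos_lt_sin_of_lt_pi h0 h
  rw [IsBitangentSphere, isTangentAt_helix_iff, isTangentAt_helix_iff, Real.sin_neg, Real.cos_neg]
  constructor
  · rintro ⟨⟨h1, h2⟩, h3, h4⟩
    refine ⟨?_, h1.symm⟩
    rw [← h1, ← sq_eq_sq₀ dist_nonneg dist_nonneg, dist_sq_eq_coord, dist_sq_eq_coord] at h3
    simp only [helix_apply_zero, helix_apply_one, helix_apply_two, Real.sin_neg,
      Real.cos_neg] at h3
    -- Equal distances give t c₀ + c₂ sin t = 0, and the two tangency equations add up to c₀ = -c₂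
    -- cos t. The factor sin t - t cos t is positive on (0, π), which forces c₂ = 0.
    have hz : S.center 2 * (Real.sin t - t * Real.cos t) = 0 := by
      linear_combination (1 / 4) * h3 + t / 2 * (h2 + h4)
    have hz0 : S.center 2 = 0 := by
      rcases mul_eq_zero.1 hz with hz | hz
      · exact hz
      · linarith
    rw [hz0] at h2 h4
    apply E3.ext
    · change _ = (0 : ℝ)
      linarith
    · change _ = -(t / Real.sin t)
      field_simp
      linarith
    · exact hz0
  · rintro ⟨hc, hr⟩
    have h1 : S.center 1 = -(t / Real.sin t) := by rw [hc]; rfl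
    have h00 : S.center 0 = 0 := by rw [hc]; rfl
    have h2 : S.center 2 = 0 := by rw [hc]; rfl
    have h3 : t / Real.sin t * Real.sin t = t := div_mul_cancel₀ _ hsin.ne'
    refine ⟨⟨hr.symm, ?_⟩, ?_, ?_⟩
    · rw [h1, h00, h2]; linarith
    · rw [hr, ← sq_eq_sq₀ dist_nonneg dist_nonneg, dist_sq_eq_coord, dist_sq_eq_coord]
      simp [h1, h00, h2]
    · rw [h1, h00, h2]; linarith

theorem bitangent_lemma {t : ℝ} (h0 : 0 < t) (h : t < π) :
    (∃! S : EuclideanGeometry.Sphere E3, IsBitangentSphere S t) ∧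
      ∀ S : EuclideanGeometry.Sphere E3, IsBitangentSphere S t →
        {p : E3 | p ∈ S} ∩ Set.range helix = {helix t, helix (-t)} := by
  have hsin := Real.sin_pos_of_pos_of_lt_pi h0 h
  refine ⟨⟨⟨!₂[0, -(t / Real.sin t), 0], dist (helix t) !₂[0, -(t / Real.sin t), 0]⟩,
    (isBitangentSphere_iff h0 h _).2 ⟨rfl, rfl⟩, fun S hS => ?_⟩, fun S hS => ?_⟩
  · obtain ⟨hc, hr⟩ := (isBitangentSphere_iff h0 h S).1 hS
    ext1
    · exact hc
    · rw [hr, hc]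
  · obtain ⟨hc, hr⟩ := (isBitangentSphere_iff h0 h S).1 hS
    apply Set.Subset.antisymm
    · rintro _ ⟨hp, s, rfl⟩
      rw [Set.mem_ofPred_eq, EuclideanGeometry.mem_sphere, hr, hc] at hp
      by_cases hs : |s| = t
      · rcases (abs_eq h0.le).1 hs with rfl | rfl
        · exact Or.inl rfl
        · exact Or.inr rfl
      · exfalso
        have hlt := sq_add_cos_lt_of_abs_ne h0 h (div_mul_cancel₀ t hsin.ne') hs
        have h1 := dist_sq_axis_helix 0 (t / Real.sin t) s
        have h2 := dist_sq_axis_helix 0 (t / Real.sin t) t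
        simp only [Real.cos_zero, Real.sin_zero, mul_one, mul_zero, zero_add] at h1 h2
        rw [dist_comm, hp, dist_comm, h2] at h1
        linarith
    · rintro _ (rfl | rfl)
      · exact ⟨hS.1.mem_sphere, t, rfl⟩
      · exact ⟨hS.2.mem_sphere, -t, rfl⟩

/-! ### Assembly of the four statements -/

theorem mainTheorem1 :
    -- Arbitrarily large neighborly families of congruent convex 3-polytopes.
    (∀ n : ℕ, 1 ≤ n →
      ∃ P : Fin n → Set E3,
        (∀ i, IsConvexPolytope3 (P i)) ∧
        (∀ i j, AreCongruent (P i) (P j)) ∧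
        IsNeighborly P ∧ MeetInCommonFacets P) ∧
    -- The Voronoi regions of evenly spaced points on the helix: they are permuted by
    -- the screw motion, and any `n + 1` consecutive ones pairwise meet in common facets.
    (∀ n : ℕ, 1 ≤ n →
      Isometry (screw n) ∧
      (∀ t : ℤ, screw n (helixPoint n t) = helixPoint n (t + 1)) ∧
      (∀ t : ℤ, screw n '' helixRegion n t = helixRegion n (t + 1)) ∧
      (∀ t : ℤ, screw n '' clipHalfspace n t = clipHalfspace n (t + 1)) ∧
      (∀ a : ℤ, MeetInCommonFacets fun i : Fin (n + 1) => helixRegion n (a + (i : ℕ)))) ∧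
    -- The clipped regions: any `n + 1` consecutive ones form a neighborly family of
    -- congruent convex 3-polytopes.
    (∀ n : ℕ, 3 ≤ n →
      (∀ t : ℤ, IsConvexPolytope3 (clippedRegion n t)) ∧
      (∀ t : ℤ, screw n '' clippedRegion n t = clippedRegion n (t + 1)) ∧
      (∀ s t : ℤ, AreCongruent (clippedRegion n s) (clippedRegion n t)) ∧
      (∀ a : ℤ, IsNeighborly fun i : Fin (n + 1) => clippedRegion n (a + (i : ℕ)))) ∧
    -- The bitangent lemma.
    (∀ t : ℝ, 0 < t → t < π →
      (∃! S : EuclideanGeometry.Sphere E3, IsBitangentSphere S t) ∧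
      ∀ S : EuclideanGeometry.Sphere E3, IsBitangentSphere S t →
        {p : E3 | p ∈ S} ∩ Set.range helix = {helix t, helix (-t)}) := by

  refine ⟨fun n _ => exists_neighborly_family n, fun n hn => ?_, fun n hn => ?_,
    fun t h0 h => bitangent_lemma h0 h⟩
  · simp only [screw_eq_screwBy]
    exact ⟨isometry_screwBy _, fun t => (helixPoint_add n t 1).symm,
      fun t => screwBy_image_helixRegion n t 1, fun t => screwBy_image_clipHalfspace n t 1,
      meetInCommonFacets_helixRegion hn⟩
  · refine ⟨isConvexPolytope3_clippedRegion hn, fun t => ?_, fun s t => ?_,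
      isNeighborly_clippedRegion hn⟩
    · rw [screw_eq_screwBy]
      exact screwBy_image_clippedRegion n t 1
    · refine ⟨screwEquiv (2 * π * (t - s : ℤ) / n), ?_⟩
      change screwBy _ '' _ = _
      rw [screwBy_image_clippedRegion, add_sub_cancel]
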